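/- For two graphs $H_1$ and $H_2$, let $r(H_1,H_2)$ denote the Ramsey number, i.e. the smallest integer $N$ such that for every simple graph $G$ on $N$ vertices, either $G$ contains $H_1$ as a (not necessarily induced) subgraph or the complement $\overline{G}$ contains $H_2$ as a subgraph. Let $C_4$ be the cycle of length $4$, and let $B_n$ be the book graph consisting of $n$ triangles sharing a common edge. Then for every prime power $q\ge 4$, $$r(C_4,B_{q^2-q-2}) = q^2+q-1.$$ -/

import Mathlib

open scoped SimpleGraph

/-- The book graph `B_n`: the spine is the edge joining the two vertices of `Fin 2`, and each of
the `n` vertices of `Fin n` (the pages) forms a triangle with it. Two distinct vertices are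
adjacent exactly when at least one of them lies on the spine. -/
def bookGraph (n : ℕ) : SimpleGraph (Fin 2 ⊕ Fin n) where
  Adj x y := x ≠ y ∧ (x.isLeft = true ∨ y.isLeft = true)
  symm := ⟨fun _ _ h => ⟨h.1.symm, h.2.symm⟩⟩
  loopless := ⟨fun _ h => h.1 rfl⟩

/-- Every graph `G` on `N` vertices contains `H₁` as a (not necessarily induced) subgraph, or its
complement contains `H₂` as a subgraph. -/
def RamseyProp {V W : Type} (H₁ : SimpleGraph V) (H₂ : SimpleGraph W) (N : ℕ) : Prop :=
  ∀ G : SimpleGraph (Fin N), H₁ ⊑ G ∨ H₂ ⊑ Gᶜ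

/-- The Ramsey number `r(H₁, H₂)`: the smallest `N` with the property above. -/
noncomputable def ramseyNumber {V W : Type} (H₁ : SimpleGraph V) (H₂ : SimpleGraph W) : ℕ :=
  sInf {N : ℕ | RamseyProp H₁ H₂ N}

/-- A positive value of the Ramsey number is a genuine minimum (`sInf ∅ = 0` plays no role). -/
theorem ramseyNumber_eq_iff_isLeast {V W : Type} (H₁ : SimpleGraph V) (H₂ : SimpleGraph W)
    {N : ℕ} (hN : 0 < N) :
    ramseyNumber H₁ H₂ = N ↔ IsLeast {N : ℕ | RamseyProp H₁ H₂ N} N := by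
  constructor
  · intro h
    have hne : {N : ℕ | RamseyProp H₁ H₂ N}.Nonempty :=
      Nat.nonempty_of_pos_sInf (by rw [← h] at hN; exact hN)
    rw [← h]
    exact ⟨Nat.sInf_mem hne, fun _ hm => Nat.sInf_le hm⟩
  · intro h
    exact h.csInf_eq

/-! A book with n pages in the complement is a nonadjacent pair whose neighbourhoods cover at most N
- n - 2 vertices: 2q - 1 for N = q^2 + q - 1, and 2q - 2 with one vertex fewer. Upper bound
(`exists_card_union_neighborFinset_lt`): if all such unions had at least 2q vertices, any two
vertices of degree at most q with a common neighbour would be adjacent. Counting paths of length two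
puts such low vertices next to every vertex of larger degree, and this forces either too few
vertices or a 4-cycle. Lower bound (`exists_graph_of_isPrimePow`): in the polarity graph of y^2 +
2xz over the field of order q, three points can be deleted so that each remaining vertex loses at
most one neighbour, its own loop included. Degrees stay at least q and codegrees at most 1, so
unions have at least 2q - 1 vertices. -/

open Finset Matrix

/-! ### Both containments as neighbourhood conditions -/

section Containment

variable {V : Type*} {G : SimpleGraph V}

theorem cycleGraph_four_isContained_iff :
    SimpleGraph.cycleGraph 4 ⊑ G ↔ ∃ a b x y, a ≠ b ∧ x ≠ y ∧
      G.Adj a x ∧ G.Adj b x ∧ G.Adj a y ∧ G.Adj b y := by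
  constructor
  · rintro ⟨f⟩
    have hadj : ∀ i j : Fin 4, (SimpleGraph.cycleGraph 4).Adj i j → G.Adj (f i) (f j) :=
      fun i j h => f.toHom.map_adj h
    refine ⟨f 0, f 2, f 1, f 3, f.injective.ne (by decide), f.injective.ne (by decide),
      hadj _ _ ?_, hadj _ _ ?_, hadj _ _ ?_, hadj _ _ ?_⟩ <;>
    simp only [SimpleGraph.cycleGraph_adj] <;> decide
  · rintro ⟨a, b, x, y, hab, hxy, hax, hbx, hay, hby⟩
    have h1 := hax.ne
    have h2 := hbx.ne
    have h3 := hay.ne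
    have h4 := hby.ne
    refine ⟨⟨⟨![a, x, b, y], ?_⟩, ?_⟩⟩
    · intro i j hij
      simp only [SimpleGraph.cycleGraph_adj] at hij
      fin_cases i <;> fin_cases j <;>
        first
          | exact absurd hij (by decide)
          | (simp; assumption)
          | (simp; apply SimpleGraph.Adj.symm; assumption)
    · intro i j hij
      fin_cases i <;> fin_cases j <;> simp at hij ⊢ <;>
        first
          | exact absurd hij (by assumption)
          | exact absurd hij.symm (by assumption)

/-- The pages can be any n vertices outside the spine and both neighbourhoods of its ends. -/
theorem bookGraph_isContained_compl_iff [Fintype V] [DecidableEq V] [DecidableRel G.Adj] (n : ℕ) :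
    bookGraph n ⊑ Gᶜ ↔ ∃ u v, u ≠ v ∧ ¬ G.Adj u v ∧
      #(G.neighborFinset u ∪ G.neighborFinset v) + 2 + n ≤ Fintype.card V := by
  have key : ∀ u v, u ≠ v → ¬ G.Adj u v →
      #(G.neighborFinset u ∪ G.neighborFinset v) + 2 +
        #((insert u (insert v (G.neighborFinset u ∪ G.neighborFinset v)))ᶜ) = Fintype.card V := by
    intro u v huv hadj
    rw [← card_add_card_compl (insert u (insert v (G.neighborFinset u ∪ G.neighborFinset v))),
      card_insert_of_notMem, card_insert_of_notMem]
    · simp [hadj]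
    · simp [huv, G.adj_comm v u, hadj]
  constructor
  · rintro ⟨f⟩
    have hadj : ∀ i j, (bookGraph n).Adj i j → f i ≠ f j ∧ ¬ G.Adj (f i) (f j) :=
      fun i j h => f.toHom.map_adj h
    have h01 := hadj (Sum.inl 0) (Sum.inl 1) ⟨by simp, by simp⟩
    refine ⟨_, _, h01.1, h01.2, ?_⟩
    rw [← key _ _ h01.1 h01.2]
    gcongr
    have hinj : Function.Injective fun i : Fin n => f (Sum.inr i) :=
      fun i j h => Sum.inr_injective (f.injective h)
    calc n = #(univ.image fun i : Fin n => f (Sum.inr i)) := by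
          rw [card_image_of_injective _ hinj]; simp
      _ ≤ _ := card_le_card ?_
    intro w hw
    obtain ⟨i, -, rfl⟩ := mem_image.1 hw
    have h0 := hadj (Sum.inl 0) (Sum.inr i) ⟨by simp, by simp⟩
    have h1 := hadj (Sum.inl 1) (Sum.inr i) ⟨by simp, by simp⟩
    simp [h0.1.symm, h1.1.symm, h0.2, h1.2]
  · rintro ⟨u, v, huv, hadj, hcard⟩
    rw [← key u v huv hadj] at hcard
    obtain ⟨T, hT, hTn⟩ := exists_subset_card_eq (Nat.le_of_add_le_add_left hcard)
    let e : Fin n ≃ T := (T.equivFinOfCardEq hTn).symm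
    have hmem : ∀ i, (e i : V) ≠ u ∧ (e i : V) ≠ v ∧ ¬ G.Adj u (e i) ∧ ¬ G.Adj v (e i) := by
      intro i
      simpa using hT (e i).2
    refine ⟨⟨⟨Sum.elim ![u, v] fun i => e i, ?_⟩, ?_⟩⟩
    · rintro (i | i) (j | j) ⟨hne, hl⟩
      · fin_cases i <;> fin_cases j <;> simp at hne ⊢ <;>
          simp [huv, huv.symm, hadj, G.adj_comm v u]
      · have := hmem j
        fin_cases i <;> simp [this, this.1.symm, this.2.1.symm]
      · have := hmem i
        fin_cases j <;> simp [this, G.adj_comm (e i : V)]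
      · simp at hl
    · rintro (i | i) (j | j) h
      · fin_cases i <;> fin_cases j <;> simp [huv, huv.symm] at h ⊢
      · have := hmem j
        fin_cases i <;> simp at h
        · exact absurd h.symm this.1
        · exact absurd h.symm this.2.1
      · have := hmem i
        fin_cases j <;> simp at h
        · exact absurd h this.1
        · exact absurd h this.2.1
      · simpa [Subtype.ext_iff] using h

/-- A graph that avoids both patterns refutes the Ramsey property for every number of vertices up
to its order. -/
theorem not_ramseyProp_of_le_card {U W : Type} [Fintype V] {H₁ : SimpleGraph U}
    {H₂ : SimpleGraph W} (h₁ : ¬ H₁ ⊑ G) (h₂ : ¬ H₂ ⊑ Gᶜ) {m : ℕ} (hm : m ≤ Fintype.card V) :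
    ¬ RamseyProp H₁ H₂ m := by
  intro h
  obtain ⟨f⟩ : Nonempty (Fin m ↪ V) := Function.Embedding.nonempty_of_card_le (by simpa using hm)
  rcases h (G.comap f) with h | h
  · exact h₁ (h.trans (SimpleGraph.Embedding.comap f G).isContained)
  · refine h₂ (h.trans ⟨⟨⟨f, ?_⟩, f.injective⟩⟩)
    rintro a b ⟨hne, hab⟩
    exact ⟨f.injective.ne hne, hab⟩

end Containment

/-! ### Upper bound: low-degree vertices in a graph without 4-cycles -/

section UpperBound

variable {V : Type*} [Fintype V] [DecidableEq V] {G : SimpleGraph V} [DecidableRel G.Adj]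

theorem card_union_neighborFinset_add_one_le {u v x : V} (hu : G.Adj u x) (hv : G.Adj v x) :
    #(G.neighborFinset u ∪ G.neighborFinset v) + 1 ≤ G.degree u + G.degree v := by
  rw [← G.card_neighborFinset_eq_degree, ← G.card_neighborFinset_eq_degree,
    ← card_union_add_card_inter]
  gcongr
  exact card_pos.2 ⟨x, by simp [hu, hv]⟩

/-- Neighbours of `v` share no neighbour but `v`, so their other neighbours form disjoint sets, all
missing `v`. -/
theorem sum_degree_sub_one_lt_card
    (hG : ∀ u v x y, u ≠ v → G.Adj u x → G.Adj v x → G.Adj u y → G.Adj v y → x = y) (v : V) :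
    ∑ u ∈ G.neighborFinset v, (G.degree u - 1) < Fintype.card V := by
  have hdisj : (G.neighborFinset v : Set V).PairwiseDisjoint
      fun u => (G.neighborFinset u).erase v := by
    intro a ha b hb hab
    rw [Function.onFun, disjoint_left]
    intro w hwa hwb
    simp only [mem_coe, SimpleGraph.mem_neighborFinset, mem_erase] at ha hb hwa hwb
    exact hab (hG v w a b hwa.1.symm ha hwa.2.symm hb hwb.2.symm)
  have hsum : ∑ u ∈ G.neighborFinset v, (G.degree u - 1) =
      #((G.neighborFinset v).biUnion fun u => (G.neighborFinset u).erase v) := by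
    rw [card_biUnion hdisj]
    refine sum_congr rfl fun u hu => ?_
    rw [card_erase_of_mem, G.card_neighborFinset_eq_degree]
    simpa [G.adj_comm] using hu
  rw [hsum, ← card_univ]
  refine card_lt_card ((ssubset_iff_of_subset (subset_univ _)).2 ⟨v, mem_univ _, ?_⟩)
  simp

/-- A graph without a 4-cycle on `q ^ 2 + q - 1` vertices has two nonadjacent vertices whose
neighbourhoods cover fewer than `2 * q` vertices. -/
theorem exists_card_union_neighborFinset_lt {q : ℕ} (hq : 4 ≤ q)
    (hV : Fintype.card V + 1 = q ^ 2 + q)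
    (hG : ∀ u v x y, u ≠ v → G.Adj u x → G.Adj v x → G.Adj u y → G.Adj v y → x = y) :
    ∃ u v, u ≠ v ∧ ¬ G.Adj u v ∧ #(G.neighborFinset u ∪ G.neighborFinset v) < 2 * q := by
  by_contra! hB
  let low (v : V) : Finset V := {u ∈ G.neighborFinset v | G.degree u ≤ q}
  have mem_low : ∀ u v, u ∈ low v ↔ G.Adj v u ∧ G.degree u ≤ q := by simp [low]
  have low_adj : ∀ u v x, u ≠ v → G.degree u ≤ q → G.degree v ≤ q → G.Adj u x → G.Adj v x →
      G.Adj u v := by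
    intro u v x huv hu hv hux hvx
    by_contra h
    have := hB u v huv h
    have := card_union_neighborFinset_add_one_le hux hvx
    omega
  -- Three low neighbours of `v` would be pairwise adjacent and form a `K₄` with `v`.
  have card_low : ∀ v, #(low v) ≤ 2 := by
    intro v
    by_contra! h
    obtain ⟨a, b, c, ha, hb, hc, hab, hac, hbc⟩ := two_lt_card_iff.1 h
    rw [mem_low] at ha hb hc
    exact hbc (hG a v b c ha.1.ne' (low_adj a b v hab ha.2 hb.2 ha.1.symm hb.1.symm) hb.1
      (low_adj a c v hac ha.2 hc.2 ha.1.symm hc.1.symm) hc.1)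
  have low_nonempty : ∀ v, q < G.degree v → (low v).Nonempty := by
    intro v hv
    by_contra! h
    have h1 := sum_degree_sub_one_lt_card hG v
    have h2 : #(G.neighborFinset v) • q ≤ ∑ u ∈ G.neighborFinset v, (G.degree u - 1) := by
      refine card_nsmul_le_sum _ _ _ fun u hu => ?_
      have : u ∉ low v := by simp [h]
      rw [mem_low] at this
      have : ¬ G.degree u ≤ q := fun h' => this ⟨by simpa using hu, h'⟩
      omega
    rw [G.card_neighborFinset_eq_degree, smul_eq_mul] at h2
    nlinarith
  by_cases hL : ∃ l, G.degree l < q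
  · obtain ⟨l, hl⟩ := hL
    let A : Finset V := {u | G.degree u ≤ q}
    -- As `l` has degree below q, every other low vertex is adjacent to it, even without a common
    -- neighbour.
    have hA : #A ≤ 3 := by
      have : A ⊆ insert l (low l) := by
        intro a ha
        have ha' : G.degree a ≤ q := by simpa [A] using ha
        rw [mem_insert, mem_low, or_iff_not_imp_left]
        refine fun hne => ⟨?_, ha'⟩
        by_contra h
        have h1 := hB l a (Ne.symm hne) h
        have h2 := card_union_le (G.neighborFinset l) (G.neighborFinset a)
        simp only [G.card_neighborFinset_eq_degree] at h2
        omega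
      have := card_le_card this
      have := card_insert_le l (low l)
      have := card_low l
      omega
    have huniv : (univ : Finset V) ⊆ A ∪ A.biUnion fun a => G.neighborFinset a := by
      intro v _
      rw [mem_union, or_iff_not_imp_left]
      intro hv
      obtain ⟨a, ha⟩ := low_nonempty v (by simpa [A] using hv)
      rw [mem_low] at ha
      exact mem_biUnion.2 ⟨a, by simpa [A] using ha.2, by simpa using ha.1.symm⟩
    have h1 := (card_le_card huniv).trans (card_union_le _ _)
    have h2 : #(A.biUnion fun a => G.neighborFinset a) ≤ #A * q :=
      card_biUnion_le_card_mul _ _ _ fun a ha => by simpa [A] using ha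
    rw [card_univ] at h1
    -- At most 3 + 3q vertices, too few once q ≥ 4.
    nlinarith
  · push Not at hL
    have two_le : ∀ v, q < G.degree v → 2 ≤ #(low v) := by
      intro v hv
      have h1 := sum_degree_sub_one_lt_card hG v
      -- Low vertices now have degree exactly q, so each falls short of q by one in the path count.
      have h2 : #(G.neighborFinset v) • q ≤
          ∑ u ∈ G.neighborFinset v, ((G.degree u - 1) + if G.degree u ≤ q then 1 else 0) := by
        refine card_nsmul_le_sum _ _ _ fun u hu => ?_
        have := hL u
        split_ifs <;> omega
      rw [sum_add_distrib, ← card_filter, G.card_neighborFinset_eq_degree, smul_eq_mul] at h2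
      change _ ≤ _ + #(low v) at h2
      nlinarith
    obtain ⟨a, ha⟩ : ∃ a, G.degree a ≤ q := by
      by_contra! h
      have : 0 < Fintype.card V := by nlinarith
      obtain ⟨v⟩ := Fintype.card_pos_iff.1 this
      obtain ⟨a, ha⟩ := low_nonempty v (h v)
      exact absurd ((mem_low _ _).1 ha).2 (by simpa using h a)
    have hhigh : 1 < #(G.neighborFinset a \ low a) := by
      have h1 := le_card_sdiff (low a) (G.neighborFinset a)
      have h2 := card_low a
      have h3 := hL a
      rw [G.card_neighborFinset_eq_degree] at h1
      omega
    obtain ⟨x, y, hx, hy, hxy⟩ := one_lt_card_iff.1 hhigh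
    have partner : ∀ x ∈ G.neighborFinset a \ low a, G.Adj a x ∧
        ∃ b, b ≠ a ∧ G.degree b ≤ q ∧ G.Adj x b ∧ G.Adj a b := by
      intro x hx
      simp only [mem_sdiff, SimpleGraph.mem_neighborFinset, mem_low, not_and, not_le] at hx
      obtain ⟨b, hb, hba⟩ := exists_mem_ne (two_le x (hx.2 hx.1)) a
      rw [mem_low] at hb
      exact ⟨hx.1, b, hba, hb.2, hb.1, low_adj a b x hba.symm ha hb.2 hx.1 hb.1.symm⟩
    have hlow : ∀ x ∈ G.neighborFinset a \ low a, q < G.degree x := by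
      intro x hx
      simp only [mem_sdiff, SimpleGraph.mem_neighborFinset, mem_low, not_and, not_le] at hx
      exact hx.2 hx.1
    -- The triangles `a x b` and `a y c` give `b` adjacent to `c`; then `a` and `b` share both the
    -- high `x` and the low `c`.
    obtain ⟨hax, b, hba, hb, hxb, hab⟩ := partner x hx
    obtain ⟨hay, c, hca, hc, hyc, hac⟩ := partner y hy
    have hbc : b ≠ c := by
      rintro rfl
      exact hxy (hG a b x y hba.symm hax hxb.symm hay hyc.symm)
    have hbc' := low_adj b c a hbc hb hc hab.symm hac.symm
    have : x = c := hG a b x c hba.symm hax hxb.symm hac hbc'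
    have := hlow x hx
    subst x
    omega

end UpperBound
-- Deleting three vertices from a polarity graph
section PolarityGraph

universe u

/-- Deleting from a polarity graph a set of three vertices which meets every neighbourhood in at
most one vertex, and no neighbourhood of an absolute vertex, leaves a graph without 4-cycles of
minimum degree at least `q`. -/
theorem exists_graph_of_polarity {P : Type u} [Fintype P] [DecidableEq P] {q : ℕ}
    (R : P → P → Prop) (hsymm : ∀ u v, R u v → R v u)
    (hR : ∀ u v x y, u ≠ v → R u x → R v x → R u y → R v y → x = y)
    (hP : Fintype.card P = q ^ 2 + q + 1) (hdeg : ∀ u, Nat.card {w // R u w} = q + 1)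
    (S : Finset P) (hS : #S = 3)
    (hS1 : ∀ u, u ∉ S → ∀ s ∈ S, ∀ t ∈ S, R u s → R u t → s = t)
    (hS2 : ∀ u, u ∉ S → R u u → ∀ s ∈ S, ¬ R u s) :
    ∃ (V : Type u) (_ : Fintype V) (_ : DecidableEq V) (G : SimpleGraph V) (_ : DecidableRel G.Adj),
      Fintype.card V + 2 = q ^ 2 + q ∧ (∀ v, q ≤ G.degree v) ∧
      ∀ u v x y, u ≠ v → G.Adj u x → G.Adj v x → G.Adj u y → G.Adj v y → x = y := by
  classical
  let G : SimpleGraph {u // u ∉ S} :=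
    { Adj := fun u v => u ≠ v ∧ R u v
      symm := ⟨fun _ _ h => ⟨h.1.symm, hsymm _ _ h.2⟩⟩
      loopless := ⟨fun _ h => h.1 rfl⟩ }
  refine ⟨{u // u ∉ S}, inferInstance, inferInstance, G, inferInstance, ?_, ?_, ?_⟩
  · have := Fintype.card_subtype_compl (fun u => u ∈ S)
    rw [Fintype.card_coe, hS, hP] at this
    rw [this]
    have : q ≠ 0 := by
      rintro rfl
      have := S.card_le_univ
      omega
    have : 0 < q ^ 2 := by positivity
    omega
  · intro v
    have h1 : #({w | R v w} : Finset P) = q + 1 := by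
      rw [← hdeg v, Nat.card_eq_fintype_card, Fintype.card_subtype]
    -- The loss at `v` is its loop or one deleted neighbour, never both.
    have h2 : #({w | R v w ∧ (w = v ∨ w ∈ S)} : Finset P) ≤ 1 := by
      rw [card_le_one]
      simp only [mem_filter, mem_univ, true_and]
      rintro a ⟨ha, rfl | haS⟩ b ⟨hb, rfl | hbS⟩
      · rfl
      · exact absurd hb (hS2 _ v.2 ha _ hbS)
      · exact absurd ha (hS2 _ v.2 hb _ haS)
      · exact hS1 _ v.2 _ haS _ hbS ha hb
    have h3 : ({w | R v w} : Finset P) ⊆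
        ({w | R v w ∧ (w = v ∨ w ∈ S)} : Finset P) ∪
          (G.neighborFinset v).map (Function.Embedding.subtype _) := by
      intro w hw
      simp only [mem_filter, mem_univ, true_and] at hw
      simp only [mem_union, mem_filter, mem_univ, true_and, mem_map,
        SimpleGraph.mem_neighborFinset, Function.Embedding.subtype_apply, or_iff_not_imp_left]
      intro h
      have h' : w ≠ v ∧ w ∉ S := by tauto
      exact ⟨⟨w, h'.2⟩, ⟨fun h => h'.1 (by rw [h]), hw⟩, rfl⟩
    have h4 := (card_le_card h3).trans (card_union_le _ _)
    rw [card_map, G.card_neighborFinset_eq_degree] at h4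
    omega
  · intro u v x y huv h1 h2 h3 h4
    exact Subtype.ext (hR u v x y (fun h => huv (Subtype.ext h)) h1.2 h2.2 h3.2 h4.2)

end PolarityGraph

/-! ### The polarity of the projective plane and the deleted triples -/

section ProjectivePlane

open Projectivization
open scoped LinearAlgebra.Projectivization

variable (K : Type*) [Field K]

/-- The involution of the projective plane induced by exchanging the outer coordinates. -/
noncomputable def reverseCoords : ℙ K (Fin 3 → K) → ℙ K (Fin 3 → K) :=
  Projectivization.map (LinearEquiv.funCongrLeft K K (Equiv.swap (0 : Fin 3) 2)).toLinearMap
    (LinearEquiv.injective _)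

theorem reverseCoords_involutive : Function.Involutive (reverseCoords K) := by
  intro v
  induction v with | h v hv =>
  simp only [reverseCoords, map_mk]
  congr 1
  ext i
  simp [LinearMap.funLeft_apply]

/-- Orthogonality with respect to the quadratic form `y ^ 2 + 2 * x * z`. -/
def ConicOrthogonal (u v : ℙ K (Fin 3 → K)) : Prop := orthogonal u (reverseCoords K v)

variable {K}

theorem conicOrthogonal_mk {v w : Fin 3 → K} (hv : v ≠ 0) (hw : w ≠ 0) :
    ConicOrthogonal K (mk K v hv) (mk K w hw) ↔ v 0 * w 2 + v 1 * w 1 + v 2 * w 0 = 0 := by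
  unfold ConicOrthogonal reverseCoords
  rw [map_mk, orthogonal_mk]
  have h1 : (Equiv.swap (0 : Fin 3) 2) 1 = 1 := by decide
  simp [dotProduct, Fin.sum_univ_three, LinearMap.funLeft_apply, h1]

theorem ConicOrthogonal.symm {u v : ℙ K (Fin 3 → K)} (h : ConicOrthogonal K u v) :
    ConicOrthogonal K v u := by
  induction u with | h u hu =>
  induction v with | h v hv =>
  rw [conicOrthogonal_mk] at h ⊢
  linear_combination h

theorem ConicOrthogonal.eq_of_ne {u v x y : ℙ K (Fin 3 → K)} (huv : u ≠ v)
    (hux : ConicOrthogonal K u x) (hvx : ConicOrthogonal K v x)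
    (huy : ConicOrthogonal K u y) (hvy : ConicOrthogonal K v y) : x = y :=
  (reverseCoords_involutive K).injective
    ((Configuration.ofField.eq_or_eq_of_orthogonal hux hvx huy hvy).resolve_left huv)

theorem card_projectivePlane [Finite K] :
    Nat.card (ℙ K (Fin 3 → K)) = Nat.card K ^ 2 + Nat.card K + 1 := by
  rw [card_of_finrank K (Fin 3 → K) (n := 3) (by simp)]
  simp [sum_range_succ]
  ring

theorem card_conicOrthogonal [Finite K] (u : ℙ K (Fin 3 → K)) :
    Nat.card {w // ConicOrthogonal K u w} = Nat.card K + 1 := by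
  classical
  have := Fintype.ofFinite (ℙ K (Fin 3 → K))
  have horder : Configuration.ProjectivePlane.order (ℙ K (Fin 3 → K)) (ℙ K (Fin 3 → K)) =
      Nat.card K := by
    have h1 := Configuration.ProjectivePlane.card_points (ℙ K (Fin 3 → K)) (ℙ K (Fin 3 → K))
    rw [← Nat.card_eq_fintype_card, card_projectivePlane] at h1
    nlinarith
  have h := Configuration.ProjectivePlane.lineCount_eq (ℙ K (Fin 3 → K)) u
  rw [horder] at h
  rw [← h]
  exact Nat.card_congr (((reverseCoords_involutive K).toPerm _).subtypeEquiv fun _ => Iff.rfl)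

theorem mk_eq_mk_of_smul {v w : Fin 3 → K} (hv : v ≠ 0) (hw : w ≠ 0) (i : Fin 3)
    (h : ∀ j, v i * w j = v j) : mk K v hv = mk K w hw :=
  (mk_eq_mk_iff' K v w hv hw).2 ⟨v i, funext h⟩

/-- The three deleted vertices in odd characteristic: two points of the conic and the intersection
of their tangents. -/
theorem exists_deletion_of_two_ne_zero (h2 : (2 : K) ≠ 0) :
    ∃ S : Set (ℙ K (Fin 3 → K)), S.ncard = 3 ∧
      (∀ u, u ∉ S → ∀ s ∈ S, ∀ t ∈ S, ConicOrthogonal K u s → ConicOrthogonal K u t → s = t) ∧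
      ∀ u, u ∉ S → ConicOrthogonal K u u → ∀ s ∈ S, ¬ ConicOrthogonal K u s := by
  have h0 : (![1, 0, 0] : Fin 3 → K) ≠ 0 := fun h => by simpa using congrFun h 0
  have h1 : (![0, 1, 0] : Fin 3 → K) ≠ 0 := fun h => by simpa using congrFun h 1
  have h3 : (![0, 0, 1] : Fin 3 → K) ≠ 0 := fun h => by simpa using congrFun h 2
  have key : ∀ u hu, mk K u hu ∉ ({mk K _ h0, mk K _ h1, mk K _ h3} : Set (ℙ K (Fin 3 → K))) →
      ¬ (u 1 = 0 ∧ u 2 = 0) ∧ ¬ (u 0 = 0 ∧ u 2 = 0) ∧ ¬ (u 0 = 0 ∧ u 1 = 0) :=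
    fun u hu huS =>
      ⟨fun h => huS <| Or.inl <|
        mk_eq_mk_of_smul hu h0 0 fun j => by fin_cases j <;> simp [h],
      fun h => huS <| Or.inr <| Or.inl <|
        mk_eq_mk_of_smul hu h1 1 fun j => by fin_cases j <;> simp [h],
      fun h => huS <| Or.inr <| Or.inr <|
        mk_eq_mk_of_smul hu h3 2 fun j => by fin_cases j <;> simp [h]⟩
  refine ⟨{mk K _ h0, mk K _ h1, mk K _ h3}, ?_, ?_, ?_⟩
  · rw [Set.ncard_eq_three]
    refine ⟨_, _, _, ?_, ?_, ?_, rfl⟩ <;> rw [Ne, mk_eq_mk_iff'] <;> rintro ⟨a, ha⟩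
    · simpa using congrFun ha 0
    · simpa using congrFun ha 0
    · simpa using congrFun ha 1
  · intro u
    induction u with | h u hu =>
    intro huS s hs t ht hus hut
    obtain ⟨e0, e1, e2⟩ := key u hu huS
    rcases hs with rfl | rfl | rfl <;> rcases ht with rfl | rfl | rfl <;>
      simp [conicOrthogonal_mk] at hus hut <;> first | rfl | (exfalso; tauto)
  · intro u
    induction u with | h u hu =>
    intro huS habs s hs hus
    obtain ⟨e0, e1, e2⟩ := key u hu huS
    rw [conicOrthogonal_mk] at habs
    rcases hs with rfl | rfl | rfl <;> simp [conicOrthogonal_mk] at hus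
    · refine e0 ⟨?_, hus⟩
      simpa [hus] using habs
    -- Odd characteristic is needed here: y^2 + 2xz with y = 0 must force x = 0 or z = 0.
    · have : 2 * (u 0 * u 2) = 0 := by linear_combination habs - u 1 * hus
      have := (mul_eq_zero.1 this).resolve_left h2
      rcases mul_eq_zero.1 this with h | h <;> tauto
    · refine e2 ⟨hus, ?_⟩
      simpa [hus] using habs

/-- The three deleted vertices in characteristic two: an absolute point and two of its neighbours
which are neither absolute nor the nucleus. -/
theorem exists_deletion_of_two_eq_zero [Finite K] (h2 : (2 : K) = 0) (hK : 4 ≤ Nat.card K) :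
    ∃ S : Set (ℙ K (Fin 3 → K)), S.ncard = 3 ∧
      (∀ u, u ∉ S → ∀ s ∈ S, ∀ t ∈ S, ConicOrthogonal K u s → ConicOrthogonal K u t → s = t) ∧
      ∀ u, u ∉ S → ConicOrthogonal K u u → ∀ s ∈ S, ¬ ConicOrthogonal K u s := by
  -- The deleted points (1,0,0), (1,1,0), (c,1,0) lie on z = 0, whose pole (1,0,0) is the only point
  -- orthogonal to two of them. Here c ≠ 1 keeps them distinct and c ≠ 0 avoids the nucleus (0,1,0).
  obtain ⟨c, hc0, hc1⟩ : ∃ c : K, c ≠ 0 ∧ c ≠ 1 := by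
    by_contra! h
    have : (Set.univ : Set K) ⊆ {0, 1} := fun c _ => or_iff_not_imp_left.2 (h c)
    have := Set.ncard_le_ncard this
    rw [Set.ncard_univ, Set.ncard_pair zero_ne_one] at this
    omega
  have h0 : (![1, 0, 0] : Fin 3 → K) ≠ 0 := fun h => by simpa using congrFun h 0
  have h1 : (![1, 1, 0] : Fin 3 → K) ≠ 0 := fun h => by simpa using congrFun h 1
  have h3 : (![c, 1, 0] : Fin 3 → K) ≠ 0 := fun h => by simpa using congrFun h 1
  have key : ∀ u hu, mk K u hu ∉ ({mk K _ h0, mk K _ h1, mk K _ h3} : Set (ℙ K (Fin 3 → K))) →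
      u 2 = 0 → u 1 ≠ 0 :=
    fun u hu huS h h' => huS <| Or.inl <|
      mk_eq_mk_of_smul hu h0 0 fun j => by fin_cases j <;> simp [h, h']
  have R0 : ∀ u hu, ConicOrthogonal K (mk K u hu) (mk K _ h0) ↔ u 2 = 0 := fun u hu => by
    simp [conicOrthogonal_mk]
  have R1 : ∀ u hu, ConicOrthogonal K (mk K u hu) (mk K _ h1) ↔ u 1 + u 2 = 0 := fun u hu => by
    simp [conicOrthogonal_mk]
  have R3 : ∀ u hu, ConicOrthogonal K (mk K u hu) (mk K _ h3) ↔ u 1 + u 2 * c = 0 :=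
    fun u hu => by simp [conicOrthogonal_mk]
  refine ⟨{mk K _ h0, mk K _ h1, mk K _ h3}, ?_, ?_, ?_⟩
  · rw [Set.ncard_eq_three]
    refine ⟨_, _, _, ?_, ?_, ?_, rfl⟩ <;> rw [Ne, mk_eq_mk_iff'] <;> rintro ⟨a, ha⟩ <;>
      have ha0 := congrFun ha 0 <;> have ha1 := congrFun ha 1 <;> simp at ha0 ha1
    · simp [ha1] at ha0
    · simp [ha1] at ha0
    · simp [ha1, hc1] at ha0
  · intro u
    induction u with | h u hu =>
    intro huS s hs t ht hus hut
    have e0 := key u hu huS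
    have e1 : u 1 + u 2 = 0 → u 1 + u 2 * c ≠ 0 := by
      intro h h'
      have : u 2 * (c - 1) = 0 := by linear_combination h' - h
      have hu2 := (mul_eq_zero.1 this).resolve_right (sub_ne_zero.2 hc1)
      exact e0 hu2 (by simpa [hu2] using h)
    rcases hs with rfl | rfl | rfl <;> rcases ht with rfl | rfl | rfl <;>
      simp only [R0, R1, R3] at hus hut <;> first | rfl | exfalso
    · exact e0 hus (by simpa [hus] using hut)
    · exact e0 hus (by simpa [hus] using hut)
    · exact e0 hut (by simpa [hut] using hus)
    · exact e1 hus hut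
    · exact e0 hut (by simpa [hut] using hus)
    · exact e1 hut hus
  · intro u
    induction u with | h u hu =>
    intro huS habs s hs hus
    -- In characteristic two the absolute points form the line y = 0.
    have hu1 : u 1 = 0 := by
      rw [conicOrthogonal_mk] at habs
      have : u 1 * u 1 = 0 := by linear_combination habs - u 0 * u 2 * h2
      simpa using this
    rcases hs with rfl | rfl | rfl <;> simp only [R0, R1, R3, hu1] at hus <;>
      exact key u hu huS (by simpa [hc0] using hus) hu1

end ProjectivePlane
-- Assembling both bounds
theorem exists_isPrimePow_field {q : ℕ} (hq : IsPrimePow q) :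
    ∃ (K : Type) (_ : Field K), Finite K ∧ Nat.card K = q := by
  obtain ⟨p, n, hp, hn, rfl⟩ := hq
  have : Fact p.Prime := ⟨hp.nat_prime⟩
  refine ⟨GaloisField p n, inferInstance, inferInstance, GaloisField.card p n hn.ne'⟩

theorem exists_graph_of_isPrimePow {q : ℕ} (hq : IsPrimePow q) (hq4 : 4 ≤ q) :
    ∃ (V : Type) (_ : Fintype V) (_ : DecidableEq V) (G : SimpleGraph V) (_ : DecidableRel G.Adj),
      Fintype.card V + 2 = q ^ 2 + q ∧ (∀ v, q ≤ G.degree v) ∧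
      ∀ u v x y, u ≠ v → G.Adj u x → G.Adj v x → G.Adj u y → G.Adj v y → x = y := by
  classical
  obtain ⟨K, _, _, rfl⟩ := exists_isPrimePow_field hq
  have := Fintype.ofFinite (Projectivization K (Fin 3 → K))
  obtain ⟨S, hS, hS1, hS2⟩ := if h : (2 : K) = 0 then exists_deletion_of_two_eq_zero h hq4
    else exists_deletion_of_two_ne_zero h
  refine exists_graph_of_polarity (ConicOrthogonal K) (fun _ _ h => h.symm)
    (fun _ _ _ _ => ConicOrthogonal.eq_of_ne) ?_ card_conicOrthogonal S.toFinset ?_ ?_ ?_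
  · rw [← Nat.card_eq_fintype_card, card_projectivePlane]
  · rw [← Set.ncard_eq_toFinset_card', hS]
  · simpa using hS1
  · simpa using hS2

theorem corollary1 (q : ℕ) (hq : IsPrimePow q) (hq4 : 4 ≤ q) :
    ramseyNumber (SimpleGraph.cycleGraph 4) (bookGraph (q ^ 2 - q - 2)) = q ^ 2 + q - 1 := by
  classical
  have hqq : 4 * q ≤ q ^ 2 := by nlinarith
  rw [ramseyNumber_eq_iff_isLeast _ _ (by omega)]
  constructor
  · intro G
    by_cases hC : SimpleGraph.cycleGraph 4 ⊑ G
    · exact Or.inl hC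
    right
    rw [cycleGraph_four_isContained_iff] at hC
    have hG : ∀ u v x y, u ≠ v → G.Adj u x → G.Adj v x → G.Adj u y → G.Adj v y → x = y := by
      intro u v x y huv h1 h2 h3 h4
      by_contra hxy
      exact hC ⟨u, v, x, y, huv, hxy, h1, h2, h3, h4⟩
    obtain ⟨u, v, huv, hadj, hlt⟩ :=
      exists_card_union_neighborFinset_lt hq4 (by simp; omega) hG
    rw [bookGraph_isContained_compl_iff]
    refine ⟨u, v, huv, hadj, ?_⟩
    rw [Fintype.card_fin]
    omega
  · intro m hm
    by_contra! hlt
    obtain ⟨V, _, _, G, _, hV, hdeg, hG⟩ := exists_graph_of_isPrimePow hq hq4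
    refine not_ramseyProp_of_le_card (G := G) ?_ ?_ (by omega) hm
    · rw [cycleGraph_four_isContained_iff]
      rintro ⟨a, b, x, y, hab, hxy, h1, h2, h3, h4⟩
      exact hxy (hG a b x y hab h1 h2 h3 h4)
    · rw [bookGraph_isContained_compl_iff]
      rintro ⟨u, v, huv, -, hcard⟩
      have h1 := card_union_add_card_inter (G.neighborFinset u) (G.neighborFinset v)
      have h2 : #(G.neighborFinset u ∩ G.neighborFinset v) ≤ 1 := by
        rw [card_le_one]
        intro x hx y hy
        simp only [mem_inter, SimpleGraph.mem_neighborFinset] at hx hy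
        exact hG u v x y huv hx.1 hx.2 hy.1 hy.2
      simp only [G.card_neighborFinset_eq_degree] at h1
      have := hdeg u
      have := hdeg v
      omega
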